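/- Let $H$ be a separable complex Hilbert space and let $\mathcal A\subseteq\mathcal B(H)$ be a commutative $C^*$-algebra, that is, a norm-closed commutative $*$-subalgebra of $\mathcal B(H)$ (not necessarily containing the identity operator). Let $\widehat{\mathcal A}$ be the spectrum of $\mathcal A$: the space of characters (nonzero multiplicative continuous linear functionals) of $\mathcal A$ with the weak-$*$ topology. Then the following conditions are equivalent: (i) $\mathcal A$ is left projective: for every left Banach $\mathcal A$-module $Y$ and every bounded left $\mathcal A$-module morphism $\varphi:Y\to\mathcal A$ that has a bounded linear right inverse, there is a bounded left $\mathcal A$-module morphism $\psi:\mathcal A\to Y$ with $\varphi\circ\psi=\mathrm{id}_{\mathcal A}$; (ii) $\widehat{\mathcal A}$ is paracompact; (iii) $\mathcal A$ contains a strictly positive element, that is, an element $h\ge 0$ with $f(h)>0$ for every nonzero positive continuous linear functional $f$ on $\mathcal A$; (iv) $\widehat{\mathcal A}$ is $\sigma$-compact; (v) $\widehat{\mathcal A}$ is a Lindelöf space; (vi) $\mathcal A$ has a sequential approximate identity bounded by one, that is, there are $e_n\in\mathcal A$ ($n\in\mathbb N$) with $\|e_n\|\le 1$ and $\|ae_n-a\|\to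 0$, $\|e_na-a\|\to 0$ for all $a\in\mathcal A$; (vii) $\mathcal H^2(\mathcal A,X)=\{0\}$ for every Banach $\mathcal A$-bimodule $X$ with $X\cdot\mathcal A=\{0\}$, where $\mathcal H^2(\mathcal A,X)$ is the second continuous Hochschild cohomology group, i.e. the space of bounded bilinear maps $f:\mathcal A\times\mathcal A\to X$ with $a\cdot f(b,c)-f(ab,c)+f(a,bc)-f(a,b)\cdot c=0$ for all $a,b,c\in\mathcal A$, modulo those of the form $f(a,b)=a\cdot g(b)-g(ab)+g(a)\cdot b$ with $g:\mathcal A\to X$ bounded linear. -/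

import Mathlib

open scoped ComplexOrder Topology

universe u v

namespace BanachHomology

/-- A left Banach module structure on the complex Banach space `X` over the (not necessarily
unital) Banach algebra `A`: a bounded bilinear associative action `(a, x) ↦ a · x`. -/
structure LeftModule (A : Type u) [NonUnitalNormedRing A] [NormedSpace ℂ A]
    (X : Type v) [NormedAddCommGroup X] [NormedSpace ℂ X] where
  /-- `lact a x` is `a · x`. -/
  lact : A →L[ℂ] X →L[ℂ] X
  mul_lact : ∀ (a b : A) (x : X), lact (a * b) x = lact a (lact b x)

/-- A Banach bimodule structure on the complex Banach space `X` over the Banach algebra `A`. -/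
structure Bimodule (A : Type u) [NonUnitalNormedRing A] [NormedSpace ℂ A]
    (X : Type v) [NormedAddCommGroup X] [NormedSpace ℂ X] extends LeftModule A X where
  /-- `ract a x` is `x · a`. -/
  ract : A →L[ℂ] X →L[ℂ] X
  mul_ract : ∀ (a b : A) (x : X), ract (a * b) x = ract b (ract a x)
  lact_ract : ∀ (a b : A) (x : X), lact a (ract b x) = ract b (lact a x)

/-- The algebra `A` as a left Banach module over itself, by multiplication. -/
noncomputable def LeftModule.self (A : Type u) [NonUnitalNormedRing A] [NormedSpace ℂ A]
    [IsScalarTower ℂ A A] [SMulCommClass ℂ A A] : LeftModule A A where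
  lact := ContinuousLinearMap.mul ℂ A
  mul_lact a b x := by simp [mul_assoc]

/-- A bounded linear map is a morphism of left Banach modules. -/
def IsMorphism {A : Type u} [NonUnitalNormedRing A] [NormedSpace ℂ A]
    {X Y : Type*} [NormedAddCommGroup X] [NormedSpace ℂ X]
    [NormedAddCommGroup Y] [NormedSpace ℂ Y]
    (M : LeftModule A X) (N : LeftModule A Y) (φ : X →L[ℂ] Y) : Prop :=
  ∀ (a : A) (x : X), φ (M.lact a x) = N.lact a (φ x)

/-- The left Banach module `P` is projective: every morphism of left Banach modules `φ : Y → P`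
which has a right inverse among bounded linear maps (so that `φ` is onto) has a right inverse among
morphisms of left Banach modules. The test modules live in the universe of `A` and `P`, which is
large enough to contain the canonical test module `A₊ ⊗̂ P`. -/
def IsProjective {A : Type u} [NonUnitalNormedRing A] [NormedSpace ℂ A]
    {P : Type u} [NormedAddCommGroup P] [NormedSpace ℂ P] (M : LeftModule A P) : Prop :=
  ∀ (Y : Type u) [NormedAddCommGroup Y] [NormedSpace ℂ Y] [CompleteSpace Y]
    (N : LeftModule A Y) (φ : Y →L[ℂ] P), IsMorphism N M φ →
    (∃ σ : P →L[ℂ] Y, φ ∘L σ = ContinuousLinearMap.id ℂ P) →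
    ∃ ψ : P →L[ℂ] Y, IsMorphism M N ψ ∧ φ ∘L ψ = ContinuousLinearMap.id ℂ P

/-- The Banach algebra `A` is left projective. -/
def IsLeftProjective (A : Type u) [NonUnitalNormedRing A] [NormedSpace ℂ A]
    [IsScalarTower ℂ A A] [SMulCommClass ℂ A A] : Prop :=
  IsProjective (LeftModule.self A)

namespace Bimodule

variable {A : Type u} [NonUnitalNormedRing A] [NormedSpace ℂ A]
  {X : Type v} [NormedAddCommGroup X] [NormedSpace ℂ X]

/-- The bimodule `X` is right annihilator: `X · A = {0}`. -/
def IsRightAnnihilator (M : Bimodule A X) : Prop := ∀ (a : A) (x : X), M.ract a x = 0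

/-- The continuous Hochschild `2`-cocycles: bounded bilinear maps `f : A × A → X` with
`a · f(b, c) - f(ab, c) + f(a, bc) - f(a, b) · c = 0`. -/
def cocycles₂ (M : Bimodule A X) : Submodule ℂ (A →L[ℂ] A →L[ℂ] X) where
  carrier := {f | ∀ a b c : A,
    M.lact a (f b c) - f (a * b) c + f a (b * c) - M.ract c (f a b) = 0}
  zero_mem' a b c := by simp
  add_mem' {f g} hf hg a b c := by
    have h := congrArg₂ (· + ·) (hf a b c) (hg a b c)
    simp only [add_zero] at h
    rw [← h]
    simp only [add_apply, map_add]
    abel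
  smul_mem' r f hf a b c := by
    have h := congrArg (r • ·) (hf a b c)
    simp only [smul_zero, smul_add, smul_sub] at h
    simpa only [smul_apply, map_smul] using h

/-- The continuous Hochschild `2`-coboundaries: the bilinear maps
`(a, b) ↦ a · g(b) - g(ab) + g(a) · b` with `g : A → X` bounded linear. -/
def coboundaries₂ (M : Bimodule A X) : Submodule ℂ (A →L[ℂ] A →L[ℂ] X) where
  carrier := {f | ∃ g : A →L[ℂ] X, ∀ a b : A,
    f a b = M.lact a (g b) - g (a * b) + M.ract b (g a)}
  zero_mem' := ⟨0, fun a b => by simp⟩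
  add_mem' := by
    rintro f f' ⟨g, hg⟩ ⟨g', hg'⟩
    refine ⟨g + g', fun a b => ?_⟩
    simp only [add_apply, map_add, hg, hg']
    abel
  smul_mem' := by
    rintro r f ⟨g, hg⟩
    refine ⟨r • g, fun a b => ?_⟩
    simp only [smul_apply, map_smul, hg, smul_add, smul_sub]

theorem coboundaries₂_le_cocycles₂ (M : Bimodule A X) : M.coboundaries₂ ≤ M.cocycles₂ := by
  rintro f ⟨g, hg⟩ a b c
  simp only [hg, map_add, map_sub, M.mul_lact, M.mul_ract, M.lact_ract, mul_assoc]
  abel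

set_option maxSynthPendingDepth 5 in
/-- The second continuous Hochschild cohomology group of `A` with coefficients in `X`. -/
abbrev H₂ (M : Bimodule A X) : Type (max u v) :=
  M.cocycles₂ ⧸ M.coboundaries₂.submoduleOf M.cocycles₂

end Bimodule

/-- `h` is a strictly positive element of the C⋆-algebra `A`: it is positive, that is, of the form
`b⋆ b`, and every nonzero positive bounded linear functional is strictly positive at `h`. -/
def IsStrictlyPositiveElement {A : Type u} [NonUnitalNormedRing A] [NormedSpace ℂ A] [Star A]
    (h : A) : Prop :=
  (∃ b : A, h = star b * b) ∧
    ∀ f : A →L[ℂ] ℂ, (∀ a : A, 0 ≤ f (star a * a)) → f ≠ 0 → 0 < f h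

/-- `A` has a sequential (two-sided) approximate identity bounded by one. -/
def HasSequentialApproxIdentity (A : Type u) [NonUnitalNormedRing A] : Prop :=
  ∃ e : ℕ → A, (∀ n, ‖e n‖ ≤ 1) ∧ ∀ a : A,
    Filter.Tendsto (fun n => a * e n) Filter.atTop (𝓝 a) ∧
    Filter.Tendsto (fun n => e n * a) Filter.atTop (𝓝 a)

/-- `H²(A, X) = 0` for every right annihilator Banach `A`-bimodule `X`. -/
def H₂VanishesOnRightAnnihilator (A : Type u) [NonUnitalNormedRing A] [NormedSpace ℂ A] : Prop :=
  ∀ (X : Type u) [NormedAddCommGroup X] [NormedSpace ℂ X] [CompleteSpace X] (M : Bimodule A X),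
    M.IsRightAnnihilator → Subsingleton M.H₂

end BanachHomology

/-!
All conditions amount to the existence of an element `h` of the algebra `A` that vanishes at no
character. Such an `h` makes the spectrum `σ`-compact and, through cutoff functions of `h`, provides
an approximate unit `e` with `e_n e_{n+1} = e_n`. If `σ` is a bounded linear section of a module
morphism onto `A`, the partial sums of `∑ a (e_{n+1} - e_n) · σ (e_{n+2} - e_{n-1})` are module
morphisms. Averaging over signs bounds a sum `∑ B (x_n, y_n)` in terms of the sums `∑ |χ (x_n)|` and
`∑ |χ (y_n)|` over the characters `χ`, so the series converges, and its limit is a section that is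
a morphism.

Conversely, separability of the Hilbert space yields a regular element `a₀`, whose support is
`σ`-compact and dense in the spectrum. If `A` is projective, restriction to the diagonal of bounded
functions from the spectrum to `A` has a section `F` that is a morphism. The values of `F a₀` on the
support of `a₀` form a separable set, and they have no common zero: if `χ` vanishes on all of them,
then the identity `s(a₀) F(b)(s) = s(b) F(a₀)(s)` gives `χ (F(b)(s)) = 0` for all `s` and `b`, and
`s = χ` gives `χ = 0`. A countable dense subset then combines into `h`. The same support turns a
locally finite refinement of the cover by the sets `{χ | χ(a) ≠ 0}` into a countable family.
-/

namespace BanachHomology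

open WeakDual Filter

section CharacterSpace

variable {B : Type*} [NonUnitalNonAssocSemiring B] [TopologicalSpace B] [Module ℂ B]

theorem continuous_character_apply (b : B) : Continuous fun χ : characterSpace ℂ B => χ b :=
  (eval_continuous b).comp continuous_subtype_val

theorem isOpen_character_ne_zero (b : B) : IsOpen {χ : characterSpace ℂ B | χ b ≠ 0} :=
  isOpen_ne.preimage (continuous_character_apply b)

theorem exists_character_apply_ne_zero (χ : characterSpace ℂ B) : ∃ b, χ b ≠ 0 := by
  by_contra! h
  exact χ.2.1 (ContinuousLinearMap.ext h)

end CharacterSpace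

section Spectrum

variable {A : Type u} [NonUnitalCStarAlgebra A]

/-- The unital extension of a character to the unitization. -/
noncomputable def characterExtension (χ : characterSpace ℂ A) :
    characterSpace ℂ (Unitization ℂ A) :=
  CharacterSpace.equivAlgHom.symm (Unitization.lift (CharacterSpace.toNonUnitalAlgHom χ))

theorem characterExtension_apply (χ : characterSpace ℂ A) (x : Unitization ℂ A) :
    characterExtension χ x = x.fst + χ x.snd := by
  change Unitization.lift (CharacterSpace.toNonUnitalAlgHom χ) x = _
  simp [Unitization.lift]

@[simp]
theorem characterExtension_inr (χ : characterSpace ℂ A) (a : A) :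
    characterExtension χ (a : Unitization ℂ A) = χ a := by
  simp [characterExtension_apply]

variable (A) in
/-- The character of the unitization that vanishes on the algebra: the point at infinity of the
spectrum. -/
noncomputable def characterAtInfinity : characterSpace ℂ (Unitization ℂ A) :=
  CharacterSpace.equivAlgHom.symm (Unitization.fstHom ℂ A)

theorem characterAtInfinity_apply (x : Unitization ℂ A) : characterAtInfinity A x = x.fst := rfl

theorem characterExtension_ne_characterAtInfinity (χ : characterSpace ℂ A) :
    characterExtension χ ≠ characterAtInfinity A := by
  obtain ⟨a, ha⟩ := exists_character_apply_ne_zero χ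
  intro h
  exact ha (by simpa [characterAtInfinity_apply] using DFunLike.congr_fun h (a : Unitization ℂ A))

theorem exists_characterExtension_eq (Φ : characterSpace ℂ (Unitization ℂ A)) {a : A}
    (ha : Φ (a : Unitization ℂ A) ≠ 0) : ∃ χ : characterSpace ℂ A, characterExtension χ = Φ := by
  let f : A →L[ℂ] ℂ := CharacterSpace.toCLM Φ ∘L ⟨Unitization.inrHom ℂ ℂ A,
    Unitization.continuous_inr⟩
  have hf (b : A) : f b = Φ (b : Unitization ℂ A) := rfl
  let χ : characterSpace ℂ A := ⟨f, fun h => ha (DFunLike.congr_fun h a), fun x y => by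
    change f (x * y) = f x * f y
    simp only [hf, Unitization.inr_mul, map_mul]⟩
  refine ⟨χ, CharacterSpace.ext fun x => ?_⟩
  calc characterExtension χ x = x.fst + Φ (x.snd : Unitization ℂ A) :=
        characterExtension_apply χ x
    _ = Φ (algebraMap ℂ (Unitization ℂ A) x.fst + x.snd) := by
        rw [map_add, AlgHomClass.commutes, Algebra.algebraMap_self_apply]
    _ = Φ x := congrArg Φ (Unitization.inl_fst_add_inr_snd_eq x)

theorem isInducing_characterExtension :
    Topology.IsInducing (characterExtension : characterSpace ℂ A → _) := by
  have h_ext : Continuous (characterExtension : characterSpace ℂ A → _) := by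
    refine Continuous.subtype_mk (WeakDual.continuous_of_continuous_eval fun x => ?_) _
    exact (continuous_const.add (continuous_character_apply x.snd)).congr
      fun χ => (characterExtension_apply χ x).symm
  have h_restrict : Continuous fun (Φ : characterSpace ℂ (Unitization ℂ A)) (a : A) =>
      Φ (a : Unitization ℂ A) :=
    continuous_pi fun a => continuous_character_apply _
  refine Topology.IsInducing.of_comp h_ext h_restrict ?_
  have h_eval : Topology.IsInducing fun (φ : WeakDual ℂ A) (a : A) => φ a := ⟨rfl⟩
  convert h_eval.comp Topology.IsInducing.subtypeVal using 1
  exact funext₂ characterExtension_inr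

instance : StarHomClass (characterSpace ℂ A) A ℂ where
  map_star χ a := by
    rw [← characterExtension_inr, Unitization.inr_star, map_star, characterExtension_inr]

theorem character_star_mul_self (χ : characterSpace ℂ A) (a : A) :
    χ (star a * a) = ((‖χ a‖ ^ 2 : ℝ) : ℂ) := by
  rw [map_mul, map_star]
  simpa using Complex.conj_mul' (χ a)

theorem isCompact_le_norm_character (a : A) {ε : ℝ} (hε : 0 < ε) :
    IsCompact {χ : characterSpace ℂ A | ε ≤ ‖χ a‖} := by
  have hK : IsCompact {Φ : characterSpace ℂ (Unitization ℂ A) | ε ≤ ‖Φ (a : Unitization ℂ A)‖} :=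
    (isClosed_le continuous_const (continuous_character_apply _).norm).isCompact
  have h_preimage := isInducing_characterExtension.isCompact_preimage' hK fun Φ hΦ =>
    exists_characterExtension_eq Φ (norm_pos_iff.1 (hε.trans_le hΦ))
  simpa using h_preimage

theorem isSigmaCompact_character_ne_zero (a : A) :
    IsSigmaCompact {χ : characterSpace ℂ A | χ a ≠ 0} := by
  refine ⟨fun n : ℕ => {χ | 1 / ((n : ℝ) + 1) ≤ ‖χ a‖},
    fun n => isCompact_le_norm_character a (by positivity), ?_⟩
  ext χ
  simp only [Set.mem_iUnion, Set.mem_ofPred_eq]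
  refine ⟨fun ⟨n, hn⟩ => norm_pos_iff.1 (lt_of_lt_of_le (by positivity) hn), fun h => ?_⟩
  obtain ⟨n, hn⟩ := exists_nat_one_div_lt (norm_pos_iff.2 h)
  exact ⟨n, hn.le⟩

instance : WeaklyLocallyCompactSpace (characterSpace ℂ A) where
  exists_compact_mem_nhds χ := by
    obtain ⟨a, ha⟩ := exists_character_apply_ne_zero χ
    have hp : 0 < ‖χ a‖ := norm_pos_iff.2 ha
    refine ⟨_, isCompact_le_norm_character a (half_pos hp), ?_⟩
    filter_upwards [(continuous_character_apply a).norm.tendsto χ |>.eventually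
      (lt_mem_nhds (half_lt_self hp))] with ψ hψ using hψ.le

end Spectrum

section GelfandDuality

variable {A : Type u} [NonUnitalCommCStarAlgebra A]

theorem norm_le_of_forall_character {a : A} {C : ℝ} (hC : 0 ≤ C)
    (h : ∀ χ : characterSpace ℂ A, ‖χ a‖ ≤ C) : ‖a‖ ≤ C := by
  rw [← Unitization.norm_inr (𝕜 := ℂ) a,
    ← (gelfandTransform_isometry (Unitization ℂ A)).norm_map_of_map_zero (map_zero _)]
  refine (ContinuousMap.norm_le _ hC).2 fun Φ => ?_
  change ‖Φ (a : Unitization ℂ A)‖ ≤ C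
  by_cases hΦ : Φ (a : Unitization ℂ A) = 0
  · simpa [hΦ] using hC
  · obtain ⟨χ, rfl⟩ := exists_characterExtension_eq Φ hΦ
    simpa using h χ

theorem eq_of_forall_character {a b : A} (h : ∀ χ : characterSpace ℂ A, χ a = χ b) : a = b := by
  rw [← sub_eq_zero, ← norm_le_zero_iff]
  exact norm_le_of_forall_character le_rfl fun χ => by simp [h χ]

theorem exists_forall_character_eq (F : C(characterSpace ℂ (Unitization ℂ A), ℂ))
    (hF : F (characterAtInfinity A) = 0) :
    ∃ a : A, ∀ χ : characterSpace ℂ A, χ a = F (characterExtension χ) := by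
  obtain ⟨z, rfl⟩ := (gelfandTransform_bijective (Unitization ℂ A)).2 F
  have hz : z.fst = 0 := hF
  refine ⟨z.snd, fun χ => ?_⟩
  change χ z.snd = characterExtension χ z
  rw [characterExtension_apply, hz, zero_add]

theorem exists_forall_character_eq_comp (h : A) {g : ℂ → ℂ} (hg : Continuous g) (hg₀ : g 0 = 0) :
    ∃ a : A, ∀ χ : characterSpace ℂ A, χ a = g (χ h) := by
  obtain ⟨a, ha⟩ := exists_forall_character_eq (A := A)
    ⟨fun Φ => g (Φ (h : Unitization ℂ A)), hg.comp (continuous_character_apply _)⟩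
    (by simp [characterAtInfinity_apply, hg₀])
  exact ⟨a, fun χ => by simpa using ha χ⟩

theorem exists_character_eq_one_of_mem_isOpen {U : Set (characterSpace ℂ A)} (hU : IsOpen U)
    {χ : characterSpace ℂ A} (hχ : χ ∈ U) :
    ∃ a : A, χ a = 1 ∧ ∀ ψ : characterSpace ℂ A, ψ ∉ U → ψ a = 0 := by
  obtain ⟨V, hV, rfl⟩ := isInducing_characterExtension.isOpen_iff.1 hU
  have h_disj : Disjoint (V ∩ {characterAtInfinity A}ᶜ)ᶜ {characterExtension χ} :=
    Set.disjoint_singleton_right.2 fun h =>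
      h ⟨hχ, characterExtension_ne_characterAtInfinity χ⟩
  obtain ⟨f, hf₀, hf₁, -⟩ := exists_continuous_zero_one_of_isClosed
    (hV.inter isOpen_compl_singleton).isClosed_compl isClosed_singleton h_disj
  obtain ⟨a, ha⟩ := exists_forall_character_eq (A := A)
    ⟨fun Φ => (f Φ : ℂ), by fun_prop⟩ (by simpa using hf₀ (by simp))
  refine ⟨a, ?_, fun ψ hψ => ?_⟩
  · simpa [hf₁ rfl] using ha χ
  · have hfψ : f (characterExtension ψ) = 0 := hf₀ fun h => hψ h.1
    simpa [hfψ] using ha ψ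

end GelfandDuality

theorem exists_pos_summable_smul {E : Type*} [NormedAddCommGroup E] [NormedSpace ℝ E]
    [CompleteSpace E] (x : ℕ → E) :
    ∃ w : ℕ → ℝ, (∀ n, 0 < w n) ∧ Summable fun n => w n • x n := by
  refine ⟨fun n => (1 / 2) ^ n / (1 + ‖x n‖), fun n => by positivity,
    summable_geometric_two.of_norm_bounded fun n => ?_⟩
  rw [norm_smul, Real.norm_of_nonneg (by positivity), div_mul_eq_mul_div,
    div_le_iff₀ (by positivity)]
  gcongr
  linarith

section NowhereVanishing

variable {A : Type u} [NonUnitalCStarAlgebra A]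

theorem exists_character_eq_zero_iff (c : ℕ → A) :
    ∃ h : A, ∀ χ : characterSpace ℂ A, χ h = 0 ↔ ∀ n, χ (c n) = 0 := by
  obtain ⟨w, hw, h_sum⟩ := exists_pos_summable_smul fun n => star (c n) * c n
  refine ⟨∑' n, w n • (star (c n) * c n), fun χ => ?_⟩
  have h_hasSum : HasSum (fun n => ((w n * ‖χ (c n)‖ ^ 2 : ℝ) : ℂ))
      (χ (∑' n, w n • (star (c n) * c n))) := by
    convert h_sum.hasSum.map χ (map_continuous χ) using 2 with n
    rw [Function.comp_apply, ← Complex.coe_smul, map_smul, character_star_mul_self, smul_eq_mul,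
      Complex.ofReal_mul]
  have h_nonneg (n : ℕ) : 0 ≤ ((w n * ‖χ (c n)‖ ^ 2 : ℝ) : ℂ) :=
    Complex.zero_le_real.2 (mul_nonneg (hw n).le (sq_nonneg _))
  calc χ (∑' n, w n • (star (c n) * c n)) = 0
      ↔ HasSum (fun n => ((w n * ‖χ (c n)‖ ^ 2 : ℝ) : ℂ)) 0 :=
        ⟨fun h => h ▸ h_hasSum, h_hasSum.unique⟩
    _ ↔ ∀ n, χ (c n) = 0 := by
        rw [hasSum_zero_iff_of_nonneg h_nonneg]
        simp [funext_iff, (hw _).ne']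

/-- An element of `A` vanishing at no character. For commutative `A` it exists if and only if the
spectrum is `σ`-compact, and it mediates between the topological and the algebraic conditions. -/
def IsNowhereVanishing (h : A) : Prop := ∀ χ : characterSpace ℂ A, χ h ≠ 0

theorem exists_isNowhereVanishing_of_countable {S : Set A} (hS : S.Countable)
    (h : ∀ χ : characterSpace ℂ A, ∃ a ∈ S, χ a ≠ 0) : ∃ h : A, IsNowhereVanishing h := by
  rcases S.eq_empty_or_nonempty with rfl | hne
  · exact ⟨0, fun χ => absurd (h χ) (by simp)⟩
  · obtain ⟨c, rfl⟩ := hS.exists_eq_range hne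
    obtain ⟨b, hb⟩ := exists_character_eq_zero_iff c
    exact ⟨b, fun χ => (hb χ).not.2 (by simpa using h χ)⟩

theorem IsNowhereVanishing.sigmaCompactSpace {h : A} (hh : IsNowhereVanishing h) :
    SigmaCompactSpace (characterSpace ℂ A) := by
  rw [← isSigmaCompact_univ_iff, ← Set.eq_univ_of_forall hh]
  exact isSigmaCompact_character_ne_zero h

theorem exists_isNowhereVanishing_of_lindelofSpace [LindelofSpace (characterSpace ℂ A)] :
    ∃ h : A, IsNowhereVanishing h := by
  obtain ⟨S, hS, h_cover⟩ := isLindelof_univ.elim_countable_subcover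
    (fun a : A => {χ : characterSpace ℂ A | χ a ≠ 0}) isOpen_character_ne_zero
    (fun χ _ => Set.mem_iUnion.2 (exists_character_apply_ne_zero χ))
  exact exists_isNowhereVanishing_of_countable hS fun χ => by
    simpa using h_cover (Set.mem_univ χ)

theorem IsStrictlyPositiveElement.isNowhereVanishing {h : A}
    (hh : IsStrictlyPositiveElement h) : IsNowhereVanishing h := fun χ =>
  have h_pos (a : A) : 0 ≤ CharacterSpace.toCLM χ (star a * a) := by
    rw [CharacterSpace.coe_toCLM, character_star_mul_self]
    exact Complex.zero_le_real.2 (sq_nonneg _)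
  (hh.2 (CharacterSpace.toCLM χ) h_pos χ.2.1).ne'

theorem IsNowhereVanishing.exists_forall_le_norm_character {h : A} (hh : IsNowhereVanishing h)
    (a : A) {ε : ℝ} (hε : 0 < ε) :
    ∃ δ > 0, ∀ χ : characterSpace ℂ A, ε ≤ ‖χ a‖ → δ ≤ ‖χ h‖ :=
  (isCompact_le_norm_character a hε).exists_forall_le'
    (continuous_character_apply h).norm.continuousOn fun χ _ => norm_pos_iff.2 (hh χ)

end NowhereVanishing

section RegularElement

variable {A : Type u} [NonUnitalCommCStarAlgebra A]

theorem dense_character_ne_zero {a₀ : A} (ha₀ : IsRegular a₀) :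
    Dense {χ : characterSpace ℂ A | χ a₀ ≠ 0} := by
  rw [dense_iff_inter_open]
  rintro U hU ⟨χ, hχ⟩
  obtain ⟨b, hb₁, hb₀⟩ := exists_character_eq_one_of_mem_isOpen hU hχ
  by_contra h_disj
  have h_mul : a₀ * b = 0 := eq_of_forall_character fun ψ => by
    rw [map_mul, map_zero, mul_eq_zero]
    by_contra! h
    exact h_disj ⟨ψ, not_not.1 fun hψ => h.2 (hb₀ ψ hψ), h.1⟩
  have hb : b = 0 := ha₀.left (h_mul.trans (mul_zero a₀).symm)
  simp [hb] at hb₁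

theorem exists_isNowhereVanishing_of_paracompactSpace [ParacompactSpace (characterSpace ℂ A)]
    {a₀ : A} (ha₀ : IsRegular a₀) : ∃ h : A, IsNowhereVanishing h := by
  obtain ⟨V, hVo, hVc, hVf, hVs⟩ := precise_refinement
    (fun a : A => {χ : characterSpace ℂ A | χ a ≠ 0}) isOpen_character_ne_zero
    (Set.iUnion_eq_univ_iff.2 exists_character_apply_ne_zero)
  obtain ⟨K, hK, hKu⟩ := isSigmaCompact_character_ne_zero a₀
  have h_countable : (⋃ n, {a | (V a ∩ K n).Nonempty}).Countable :=
    Set.countable_iUnion fun n => (hVf.finite_nonempty_inter_compact (hK n)).countable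
  refine exists_isNowhereVanishing_of_countable h_countable fun χ => ?_
  obtain ⟨a, ha⟩ := Set.mem_iUnion.1 (hVc.ge (Set.mem_univ χ))
  obtain ⟨ψ, hψV, hψ⟩ := (dense_character_ne_zero ha₀).inter_open_nonempty _ (hVo a) ⟨χ, ha⟩
  obtain ⟨n, hn⟩ := Set.mem_iUnion.1 (hKu.ge hψ)
  exact ⟨a, Set.mem_iUnion.2 ⟨n, ψ, hψV, hn⟩, hVs a ha⟩

end RegularElement

section StrictlyPositive

variable {A : Type u} [NonUnitalCStarAlgebra A]

theorem apply_star_mul_eq_zero [PartialOrder A] [StarOrderedRing A] (f : A →ₚ[ℂ] ℂ) {y : A}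
    (hy : f (star y * y) = 0) (x : A) : f (star x * y) = 0 := by
  have h_norm : ‖f.toPreGNS y‖ = 0 := by
    have h_sq := f.preGNS_norm_sq (f.toPreGNS y)
    rw [f.ofPreGNS_toPreGNS, hy] at h_sq
    exact_mod_cast pow_eq_zero_iff two_ne_zero |>.1 h_sq
  calc f (star x * y) = inner ℂ (f.toPreGNS x) (f.toPreGNS y) := rfl
    _ = 0 := by
        rw [← norm_le_zero_iff]
        simpa [h_norm] using norm_inner_le_norm (𝕜 := ℂ) (f.toPreGNS x) (f.toPreGNS y)

theorem HasSequentialApproxIdentity.exists_isStrictlyPositiveElement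
    (hA : HasSequentialApproxIdentity A) : ∃ h : A, IsStrictlyPositiveElement h := by
  let _ : PartialOrder A := CStarAlgebra.spectralOrder A
  have _ : StarOrderedRing A := CStarAlgebra.spectralOrderedRing A
  obtain ⟨e, -, he⟩ := hA
  obtain ⟨w, hw, h_sum⟩ := exists_pos_summable_smul fun n => star (e n) * e n
  have h_nonneg (n : ℕ) : 0 ≤ w n • (star (e n) * e n) :=
    smul_nonneg (hw n).le (star_mul_self_nonneg _)
  refine ⟨∑' n, w n • (star (e n) * e n),
    CStarAlgebra.nonneg_iff_eq_star_mul_self.1 (tsum_nonneg h_nonneg), fun f hf hf₀ => ?_⟩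
  let F : A →ₚ[ℂ] ℂ := .mk₀ f.toLinearMap fun a ha => by
    obtain ⟨b, rfl⟩ := CStarAlgebra.nonneg_iff_eq_star_mul_self.1 ha
    exact hf b
  have hF (n : ℕ) : 0 ≤ f (w n • (star (e n) * e n)) := F.map_nonneg (h_nonneg n)
  have h_map := h_sum.hasSum.mapL f
  refine (h_map.nonneg hF).lt_of_ne fun h_zero => hf₀ (ContinuousLinearMap.ext fun a => ?_)
  have h_apply (n : ℕ) : f (star (e n) * e n) = 0 := by
    rw [← h_zero, hasSum_zero_iff_of_nonneg hF] at h_map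
    simpa [← Complex.coe_smul, (hw n).ne'] using congrFun h_map n
  have h_annihilate (n : ℕ) : f (a * e n) = 0 := by
    rw [← star_star a]
    exact apply_star_mul_eq_zero F (h_apply n) (star a)
  refine tendsto_nhds_unique ((f.continuous.tendsto a).comp (he a).1) ?_
  simp [Function.comp_def, h_annihilate]

end StrictlyPositive

section Cutoff

/-- A continuous piecewise linear function of `t ≥ 0` which vanishes near `0`, equals `1` for
`2 ≤ (2 ^ n - 1) * t`, and vanishes identically for `n = 0`. -/
noncomputable def cutoff (n : ℕ) (t : ℝ) : ℝ := max 0 (min 1 ((2 ^ n - 1) * t - 1))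

theorem continuous_cutoff (n : ℕ) : Continuous (cutoff n) := by
  unfold cutoff
  fun_prop

theorem cutoff_zero_left (t : ℝ) : cutoff 0 t = 0 := by simp [cutoff]

theorem cutoff_zero_right (n : ℕ) : cutoff n 0 = 0 := by simp [cutoff]

theorem cutoff_nonneg (n : ℕ) (t : ℝ) : 0 ≤ cutoff n t := le_max_left _ _

theorem cutoff_le_one (n : ℕ) (t : ℝ) : cutoff n t ≤ 1 := max_le zero_le_one (min_le_left _ _)

theorem cutoff_eq_one {n : ℕ} {t : ℝ} (h : 2 ≤ (2 ^ n - 1) * t) : cutoff n t = 1 := by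
  rw [cutoff, min_eq_left (by linarith), max_eq_right zero_le_one]

theorem cutoff_mul_cutoff_succ (n : ℕ) {t : ℝ} (ht : 0 ≤ t) :
    cutoff n t * cutoff (n + 1) t = cutoff n t := by
  rcases le_total ((2 ^ n - 1) * t) 1 with h | h
  · have h_zero : cutoff n t = 0 := max_eq_left ((min_le_right _ _).trans (sub_nonpos.2 h))
    rw [h_zero, zero_mul]
  · rw [cutoff_eq_one (n := n + 1), mul_one]
    rw [pow_succ]
    linarith

theorem eventually_forall_cutoff_eq_one {δ : ℝ} (hδ : 0 < δ) :
    ∀ᶠ n in atTop, ∀ t, δ ≤ t → cutoff n t = 1 := by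
  filter_upwards [(tendsto_pow_atTop_atTop_of_one_lt one_lt_two).eventually_ge_atTop
    (1 + 2 / δ)] with n hn t ht
  refine cutoff_eq_one ?_
  calc (2 : ℝ) = 2 / δ * δ := (div_mul_cancel₀ _ hδ.ne').symm
    _ ≤ (2 ^ n - 1) * t := mul_le_mul (le_sub_iff_add_le'.2 hn) ht hδ.le
        (sub_nonneg.2 (one_le_pow₀ one_le_two))

end Cutoff

section ApproximateUnit

variable {A : Type u} [NonUnitalCommCStarAlgebra A]

/-- A sequential approximate identity consisting of nonnegative elements of the unit ball, each of
which acts as a unit on its predecessor. Positivity is encoded through the characters, and the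
sequence starts at zero, so that the increments `e (n + 1) - e n` sum up to an approximate
identity. -/
structure IsAlmostIdempotentApproxUnit (e : ℕ → A) : Prop where
  zero : e 0 = 0
  apply_nonneg : ∀ (n : ℕ) (χ : characterSpace ℂ A), 0 ≤ χ (e n)
  norm_le_one : ∀ n, ‖e n‖ ≤ 1
  mul_succ : ∀ n, e n * e (n + 1) = e n
  tendsto : ∀ a, Tendsto (fun n => a * e n) atTop (𝓝 a)

theorem IsNowhereVanishing.tendsto_mul_cutoff {h : A} (hh : IsNowhereVanishing h) {e : ℕ → A}
    (he : ∀ (n : ℕ) (χ : characterSpace ℂ A), χ (e n) = (cutoff n ‖χ h‖ : ℂ)) (a : A) :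
    Tendsto (fun n => a * e n) atTop (𝓝 a) := by
  refine Metric.tendsto_nhds.2 fun ε hε => ?_
  obtain ⟨δ, hδ, h_le⟩ := hh.exists_forall_le_norm_character a (half_pos hε)
  filter_upwards [eventually_forall_cutoff_eq_one hδ] with n hn
  rw [dist_comm, dist_eq_norm]
  refine (norm_le_of_forall_character (half_pos hε).le fun χ => ?_).trans_lt (half_lt_self hε)
  have h_apply : ‖χ (a - a * e n)‖ = ‖χ a‖ * (1 - cutoff n ‖χ h‖) := by
    rw [← Real.norm_of_nonneg (sub_nonneg.2 (cutoff_le_one _ _)), ← Complex.norm_real, ← norm_mul,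
      map_sub, map_mul, he, Complex.ofReal_sub, Complex.ofReal_one, mul_one_sub]
  rw [h_apply]
  by_cases hχ : ε / 2 ≤ ‖χ a‖
  · simpa [hn _ (h_le χ hχ)] using (half_pos hε).le
  · calc ‖χ a‖ * (1 - cutoff n ‖χ h‖) ≤ ‖χ a‖ :=
          mul_le_of_le_one_right (norm_nonneg _) (sub_le_self _ (cutoff_nonneg _ _))
      _ ≤ ε / 2 := (not_le.1 hχ).le

theorem IsNowhereVanishing.exists_isAlmostIdempotentApproxUnit {h : A}
    (hh : IsNowhereVanishing h) : ∃ e : ℕ → A, IsAlmostIdempotentApproxUnit e := by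
  choose e he using fun n => exists_forall_character_eq_comp h (g := fun z => (cutoff n ‖z‖ : ℂ))
    (Complex.continuous_ofReal.comp ((continuous_cutoff n).comp continuous_norm))
    (by simp [cutoff_zero_right])
  refine ⟨e, ?_, fun n χ => ?_, fun n => ?_, fun n => ?_, hh.tendsto_mul_cutoff he⟩
  · exact eq_of_forall_character fun χ => by simp [he, cutoff_zero_left]
  · rw [he]
    exact Complex.zero_le_real.2 (cutoff_nonneg _ _)
  · refine norm_le_of_forall_character zero_le_one fun χ => ?_
    rw [he, Complex.norm_real, Real.norm_of_nonneg (cutoff_nonneg _ _)]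
    exact cutoff_le_one _ _
  · refine eq_of_forall_character fun χ => ?_
    rw [map_mul, he, he, ← Complex.ofReal_mul, cutoff_mul_cutoff_succ n (norm_nonneg _)]

namespace IsAlmostIdempotentApproxUnit

variable {e : ℕ → A}

theorem hasSequentialApproxIdentity (he : IsAlmostIdempotentApproxUnit e) :
    HasSequentialApproxIdentity A :=
  ⟨e, he.norm_le_one, fun a => ⟨he.tendsto a, by simpa only [mul_comm] using he.tendsto a⟩⟩

theorem apply_le_one (he : IsAlmostIdempotentApproxUnit e) (n : ℕ) (χ : characterSpace ℂ A) :
    χ (e n) ≤ 1 := by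
  rw [← Complex.norm_of_nonneg' (he.apply_nonneg n χ)]
  exact_mod_cast (NonUnitalStarAlgHom.norm_apply_le χ (e n)).trans (he.norm_le_one n)

theorem monotone_apply (he : IsAlmostIdempotentApproxUnit e) (χ : characterSpace ℂ A) :
    Monotone fun n => χ (e n) :=
  monotone_nat_of_le_succ fun n =>
    calc χ (e n) = χ (e n) * χ (e (n + 1)) := by rw [← map_mul, he.mul_succ]
      _ ≤ χ (e (n + 1)) :=
        mul_le_of_le_one_left (he.apply_nonneg (n + 1) χ) (he.apply_le_one n χ)

theorem mul_eq_left (he : IsAlmostIdempotentApproxUnit e) {m n : ℕ} (hmn : m < n) :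
    e m * e n = e m := by
  induction n, hmn using Nat.le_induction with
  | base => exact he.mul_succ m
  | succ n _ ih => rw [← ih, mul_assoc, he.mul_succ]

theorem increment_mul (he : IsAlmostIdempotentApproxUnit e) (n : ℕ) :
    (e (n + 1) - e n) * (e (n + 2) - e (n - 1)) = e (n + 1) - e n := by
  rcases n with _ | n
  · simp [he.zero, he.mul_succ]
  · have h_succ : e (n + 2) * e n = e n := by rw [mul_comm, he.mul_eq_left (by lia)]
    have h_self : e (n + 1) * e n = e n := by rw [mul_comm, he.mul_succ]
    simp only [Nat.add_sub_cancel, sub_mul, mul_sub, h_succ, h_self, he.mul_succ,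
      he.mul_eq_left (show n + 1 < n + 1 + 2 by lia), sub_self, sub_zero]

end IsAlmostIdempotentApproxUnit

end ApproximateUnit

section Averaging

theorem norm_add_sum_le_of_insert {ι E : Type*} [SeminormedAddCommGroup E] [DecidableEq ι] {i : ι}
    {s : Finset ι} (hi : i ∉ s) {x : ι → E} {z : E} {C : ℝ}
    (h : ∀ ε : ι → ℤˣ, ‖z + ∑ j ∈ insert i s, ε j • x j‖ ≤ C) (δ : ℤˣ) (ε : ι → ℤˣ) :
    ‖z + δ • x i + ∑ j ∈ s, ε j • x j‖ ≤ C := by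
  convert h (Function.update ε i δ) using 2
  rw [Finset.sum_insert hi, Function.update_self, add_assoc]
  congr 2
  refine Finset.sum_congr rfl fun j hj => ?_
  rw [Function.update_of_ne (ne_of_mem_of_not_mem hj hi)]

theorem norm_add_sum_apply_le {𝕜 ι E F G : Type*} [RCLike 𝕜] [NormedAddCommGroup E]
    [NormedSpace 𝕜 E] [NormedAddCommGroup F] [NormedSpace 𝕜 F] [NormedAddCommGroup G]
    [NormedSpace 𝕜 G] (B : E →L[𝕜] F →L[𝕜] G) (x : ι → E) (y : ι → F) {C D : ℝ}
    (s : Finset ι) (z : E) (w : F)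
    (hx : ∀ ε : ι → ℤˣ, ‖z + ∑ i ∈ s, ε i • x i‖ ≤ C)
    (hy : ∀ ε : ι → ℤˣ, ‖w + ∑ i ∈ s, ε i • y i‖ ≤ D) :
    ‖B z w + ∑ i ∈ s, B (x i) (y i)‖ ≤ ‖B‖ * C * D := by
  classical
  induction s using Finset.induction_on generalizing z w with
  | empty =>
    have hz : ‖z‖ ≤ C := by simpa using hx 1
    have hw : ‖w‖ ≤ D := by simpa using hy 1
    have hC : 0 ≤ C := (norm_nonneg z).trans hz
    simpa using (B.le_opNorm₂ z w).trans (by gcongr)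
  | insert i s hi ih =>
    have h_sign (δ : ℤˣ) := ih _ _ (norm_add_sum_le_of_insert hi hx δ)
      (norm_add_sum_le_of_insert hi hy δ)
    -- In the mean of the two choices of the sign at `i`, the mixed terms `B z (y i)` and
    -- `B (x i) w` cancel.
    have h_mean : B z w + ∑ j ∈ insert i s, B (x j) (y j) = (2⁻¹ : 𝕜) •
        ((B (z + (1 : ℤˣ) • x i) (w + (1 : ℤˣ) • y i) + ∑ j ∈ s, B (x j) (y j)) +
        (B (z + (-1 : ℤˣ) • x i) (w + (-1 : ℤˣ) • y i) + ∑ j ∈ s, B (x j) (y j))) := by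
      rw [Finset.sum_insert hi]
      simp only [one_smul, Units.neg_smul, map_add, map_neg, add_apply, neg_apply]
      module
    calc ‖B z w + ∑ j ∈ insert i s, B (x j) (y j)‖
        ≤ 2⁻¹ * (‖B‖ * C * D + ‖B‖ * C * D) := by
          rw [h_mean, norm_smul, norm_inv, RCLike.norm_ofNat]
          gcongr
          exact norm_add_le_of_le (h_sign 1) (h_sign (-1))
      _ = ‖B‖ * C * D := by ring

variable {A : Type u} [NonUnitalCommCStarAlgebra A] {ι : Type*}

theorem norm_sum_smul_le_of_forall_character {s : Finset ι} {x : ι → A} {C : ℝ} (hC : 0 ≤ C)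
    (hx : ∀ χ : characterSpace ℂ A, ∑ i ∈ s, ‖χ (x i)‖ ≤ C) (ε : ι → ℤˣ) :
    ‖∑ i ∈ s, ε i • x i‖ ≤ C := by
  refine norm_le_of_forall_character hC fun χ => le_trans ?_ (hx χ)
  rw [map_sum]
  refine norm_sum_le_of_le s fun i _ => ?_
  rw [Units.smul_def, map_zsmul, ← Units.smul_def, norm_units_zsmul]

theorem norm_sum_apply_le_of_forall_character {G : Type*} [NormedAddCommGroup G]
    [NormedSpace ℂ G] (B : A →L[ℂ] A →L[ℂ] G) {s : Finset ι}
    {x y : ι → A} {C D : ℝ} (hC : 0 ≤ C) (hD : 0 ≤ D)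
    (hx : ∀ χ : characterSpace ℂ A, ∑ i ∈ s, ‖χ (x i)‖ ≤ C)
    (hy : ∀ χ : characterSpace ℂ A, ∑ i ∈ s, ‖χ (y i)‖ ≤ D) :
    ‖∑ i ∈ s, B (x i) (y i)‖ ≤ ‖B‖ * C * D := by
  simpa using norm_add_sum_apply_le B x y s 0 0
    (by simpa using norm_sum_smul_le_of_forall_character hC hx)
    (by simpa using norm_sum_smul_le_of_forall_character hD hy)

end Averaging

theorem sum_Ico_sub_le {α : Type*} [AddCommGroup α] [PartialOrder α] [IsOrderedAddMonoid α]
    {G : ℕ → α} (hG : Monotone G) {C : α} (hC : ∀ n, G n ≤ C) {k l : ℕ} (hkl : k ≤ l) (j : ℕ) :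
    ∑ n ∈ Finset.Ico k l, (G (n + j) - G n) ≤ j • (C - G k) := by
  induction j with
  | zero => simp
  | succ j ih =>
    have h_telescope : ∑ n ∈ Finset.Ico k l, (G (n + 1 + j) - G (n + j)) = G (l + j) - G (k + j) :=
      Finset.sum_Ico_sub (fun n => G (n + j)) hkl
    calc ∑ n ∈ Finset.Ico k l, (G (n + (j + 1)) - G n)
        = G (l + j) - G (k + j) + ∑ n ∈ Finset.Ico k l, (G (n + j) - G n) := by
          rw [← h_telescope, ← Finset.sum_add_distrib]
          refine Finset.sum_congr rfl fun n _ => ?_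
          rw [add_right_comm, sub_add_sub_cancel, add_assoc]
      _ ≤ (C - G k) + j • (C - G k) :=
          add_le_add (sub_le_sub (hC _) (hG (Nat.le_add_right k j))) ih
      _ = (j + 1) • (C - G k) := (succ_nsmul' _ _).symm

section Morphisms

variable {A : Type u} [NonUnitalNormedRing A] [NormedSpace ℂ A] {Y : Type*}
  [NormedAddCommGroup Y] [NormedSpace ℂ Y]

theorem exists_isMorphism_section_of_cauchySeq {P : Type*} [NormedAddCommGroup P] [NormedSpace ℂ P]
    [CompleteSpace P] [CompleteSpace Y] {M : LeftModule A P} {N : LeftModule A Y} {φ : Y →L[ℂ] P}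
    {ψ : ℕ → P →L[ℂ] Y} (hψ : ∀ k, IsMorphism M N (ψ k))
    (h_cauchy : ∀ x, CauchySeq fun k => ψ k x)
    (hφψ : ∀ x, Tendsto (fun k => φ (ψ k x)) atTop (𝓝 x)) :
    ∃ Ψ : P →L[ℂ] Y, IsMorphism M N Ψ ∧ φ ∘L Ψ = ContinuousLinearMap.id ℂ P := by
  choose Ψ hΨ using fun x => cauchySeq_tendsto_of_complete (h_cauchy x)
  refine ⟨continuousLinearMapOfTendsto ψ (tendsto_pi_nhds.2 hΨ), fun a x => ?_, ?_⟩
  · have h_lim : Tendsto (fun k => ψ k (M.lact a x)) atTop (𝓝 (N.lact a (Ψ x))) := by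
      simp only [hψ _ a x]
      exact ((N.lact a).continuous.tendsto _).comp (hΨ x)
    exact tendsto_nhds_unique (hΨ (M.lact a x)) h_lim
  · exact ContinuousLinearMap.ext fun x =>
      tendsto_nhds_unique ((φ.continuous.tendsto _).comp (hΨ x)) (hφψ x)

variable [IsScalarTower ℂ A A] [SMulCommClass ℂ A A]

/-- The morphism `a ↦ ∑_{n < k} a (e_{n+1} - e_n) · σ (e_{n+2} - e_{n-1})`, where `e_{-1}` is read
as `e_0`. For an almost idempotent approximate unit `e` and a linear section `σ` of a morphism onto
`A`, these morphisms converge to a section which is a morphism. -/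
noncomputable def sectionApprox (N : LeftModule A Y) (σ : A →L[ℂ] Y) (e : ℕ → A) (k : ℕ) :
    A →L[ℂ] Y :=
  ∑ n ∈ Finset.range k, N.lact.flip (σ (e (n + 2) - e (n - 1))) ∘L
    (ContinuousLinearMap.mul ℂ A).flip (e (n + 1) - e n)

variable (N : LeftModule A Y) (σ : A →L[ℂ] Y) (e : ℕ → A) (k : ℕ)

theorem sectionApprox_apply (a : A) : sectionApprox N σ e k a =
    ∑ n ∈ Finset.range k, N.lact (a * (e (n + 1) - e n)) (σ (e (n + 2) - e (n - 1))) := by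
  rw [sectionApprox, sum_apply]
  rfl

theorem isMorphism_sectionApprox : IsMorphism (LeftModule.self A) N (sectionApprox N σ e k) := by
  intro a b
  change sectionApprox N σ e k (a * b) = _
  simp only [sectionApprox_apply, map_sum, mul_assoc, N.mul_lact a]

end Morphisms

namespace IsAlmostIdempotentApproxUnit

variable {A : Type u} [NonUnitalCommCStarAlgebra A] {e : ℕ → A}
  (he : IsAlmostIdempotentApproxUnit e)

include he

theorem norm_one_sub_apply_le_one (n : ℕ) (χ : characterSpace ℂ A) : ‖1 - χ (e n)‖ ≤ 1 := by
  rw [← Complex.real_le_real, Complex.norm_of_nonneg' (sub_nonneg.2 (he.apply_le_one n χ)),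
    Complex.ofReal_one]
  exact sub_le_self 1 (he.apply_nonneg n χ)

theorem sum_norm_apply_sub_le (χ : characterSpace ℂ A) {f : ℕ → ℕ} (hf : Monotone f) {k l : ℕ}
    (hkl : k ≤ l) (j : ℕ) :
    ∑ n ∈ Finset.Ico k l, ‖χ (e (f (n + j)) - e (f n))‖ ≤ j * ‖1 - χ (e (f k))‖ := by
  have h_mono : Monotone fun n => χ (e (f n)) := (he.monotone_apply χ).comp hf
  have h_norm (n : ℕ) : ((‖χ (e (f (n + j)) - e (f n))‖ : ℝ) : ℂ) =
      χ (e (f (n + j))) - χ (e (f n)) := by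
    rw [map_sub, Complex.norm_of_nonneg' (sub_nonneg.2 (h_mono (Nat.le_add_right n j)))]
  rw [← Complex.real_le_real, Complex.ofReal_mul, Complex.ofReal_sum,
    Complex.norm_of_nonneg' (sub_nonneg.2 (he.apply_le_one (f k) χ)), Finset.sum_congr rfl
    fun n _ => h_norm n, Complex.ofReal_natCast, ← nsmul_eq_mul]
  exact sum_Ico_sub_le h_mono (fun n => he.apply_le_one (f n) χ) hkl j

theorem map_sectionApprox {Y : Type*} [NormedAddCommGroup Y] [NormedSpace ℂ Y]
    {N : LeftModule A Y} {φ : Y →L[ℂ] A} (hφ : IsMorphism N (LeftModule.self A) φ)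
    {σ : A →L[ℂ] Y} (hσ : ∀ a, φ (σ a) = a) (k : ℕ) (a : A) :
    φ (sectionApprox N σ e k a) = a * e k := by
  rw [sectionApprox_apply, map_sum]
  calc ∑ n ∈ Finset.range k, φ (N.lact (a * (e (n + 1) - e n)) (σ (e (n + 2) - e (n - 1))))
      = ∑ n ∈ Finset.range k, (a * e (n + 1) - a * e n) := by
        refine Finset.sum_congr rfl fun n _ => ?_
        rw [hφ, hσ]
        change a * (e (n + 1) - e n) * (e (n + 2) - e (n - 1)) = _
        rw [mul_assoc, he.increment_mul, mul_sub]
    _ = a * e k := by rw [Finset.sum_range_sub (fun n => a * e n), he.zero, mul_zero, sub_zero]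

theorem norm_sectionApprox_sub_le {Y : Type*} [NormedAddCommGroup Y] [NormedSpace ℂ Y]
    (N : LeftModule A Y) (σ : A →L[ℂ] Y) (a : A) {k l : ℕ} (hkl : k ≤ l) :
    ‖sectionApprox N σ e l a - sectionApprox N σ e k a‖ ≤
      ‖(N.lact.flip ∘L σ).flip‖ * ‖a - a * e k‖ * 3 := by
  rw [sectionApprox_apply, sectionApprox_apply, ← Finset.sum_Ico_eq_sub _ hkl]
  refine norm_sum_apply_le_of_forall_character (N.lact.flip ∘L σ).flip (norm_nonneg _)
    zero_le_three (fun χ => ?_) fun χ => ?_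
  · have h_bound := he.sum_norm_apply_sub_le χ monotone_id hkl 1
    rw [Nat.cast_one, one_mul] at h_bound
    calc ∑ n ∈ Finset.Ico k l, ‖χ (a * (e (n + 1) - e n))‖
        = ‖χ a‖ * ∑ n ∈ Finset.Ico k l, ‖χ (e (n + 1) - e n)‖ := by
          simp only [map_mul, norm_mul, Finset.mul_sum]
      _ ≤ ‖χ a‖ * ‖1 - χ (e k)‖ := mul_le_mul_of_nonneg_left h_bound (norm_nonneg _)
      _ = ‖χ (a - a * e k)‖ := by rw [← norm_mul, mul_one_sub, map_sub, map_mul]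
      _ ≤ ‖a - a * e k‖ := NonUnitalStarAlgHom.norm_apply_le χ _
  · calc ∑ n ∈ Finset.Ico k l, ‖χ (e (n + 2) - e (n - 1))‖
        ≤ (3 : ℕ) * ‖1 - χ (e (k - 1))‖ :=
          he.sum_norm_apply_sub_le χ (f := fun n => n - 1)
            (fun _ _ h => Nat.sub_le_sub_right h 1) hkl 3
      _ ≤ 3 := by simpa using he.norm_one_sub_apply_le_one (k - 1) χ

theorem isLeftProjective : IsLeftProjective A := by
  rintro Y _ _ _ N φ hφ ⟨σ, hσ⟩
  refine exists_isMorphism_section_of_cauchySeq (isMorphism_sectionApprox N σ e) (fun a => ?_)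
    fun a => ?_
  · refine cauchySeq_of_le_tendsto_0' (fun k => ‖(N.lact.flip ∘L σ).flip‖ * ‖a - a * e k‖ * 3)
      (fun k l hkl => ?_) ?_
    · rw [dist_comm, dist_eq_norm]
      exact he.norm_sectionApprox_sub_le N σ a hkl
    · have h_lim : Tendsto (fun k => ‖a - a * e k‖) atTop (𝓝 0) := by
        simpa using ((he.tendsto a).const_sub a).norm
      simpa using (h_lim.const_mul ‖(N.lact.flip ∘L σ).flip‖).mul_const 3
  · simpa only [he.map_sectionApprox hφ (DFunLike.congr_fun hσ)] using he.tendsto a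

end IsAlmostIdempotentApproxUnit

section Cohomology

section Bilinear

variable {𝕜 E F G : Type*} [NontriviallyNormedField 𝕜] [NormedAddCommGroup E] [NormedSpace 𝕜 E]
  [NormedAddCommGroup F] [NormedSpace 𝕜 F] [NormedAddCommGroup G] [NormedSpace 𝕜 G]

/-- A bounded bilinear map with values in a subspace `S`, as a bounded bilinear map into `S`. -/
noncomputable def codRestrictBilinear (B : E →L[𝕜] F →L[𝕜] G) (S : Submodule 𝕜 G)
    (hB : ∀ x y, B x y ∈ S) : E →L[𝕜] F →L[𝕜] S :=
  LinearMap.mkContinuous₂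
    (LinearMap.mk₂ 𝕜 (fun x y => ⟨B x y, hB x y⟩)
      (fun _ _ _ => Subtype.ext (B.map_add₂ _ _ _))
      (fun _ _ _ => Subtype.ext (B.map_smul₂ _ _ _))
      (fun _ _ _ => Subtype.ext (map_add _ _ _))
      (fun _ _ _ => Subtype.ext (map_smul _ _ _)))
    ‖B‖ fun x y => B.le_opNorm₂ x y

end Bilinear

namespace LeftModule

variable {A : Type u} [NonUnitalNormedRing A] [NormedSpace ℂ A] {X Y : Type*}
  [NormedAddCommGroup X] [NormedSpace ℂ X] [NormedAddCommGroup Y] [NormedSpace ℂ Y]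

/-- The submodule of a left Banach module carried by an invariant subspace. -/
noncomputable def restrict (M : LeftModule A X) (S : Submodule ℂ X)
    (hS : ∀ a, ∀ x ∈ S, M.lact a x ∈ S) : LeftModule A S where
  lact := codRestrictBilinear (M.lact.flip ∘L S.subtypeL).flip S fun a x => hS a x x.2
  mul_lact a b x := Subtype.ext (M.mul_lact a b x)

/-- The product of two left Banach modules. -/
noncomputable def prod (M : LeftModule A X) (N : LeftModule A Y) : LeftModule A (X × Y) where
  lact := ContinuousLinearMap.prodMapL ℂ X X Y Y ∘L M.lact.prod N.lact
  mul_lact a b p := Prod.ext (M.mul_lact a b p.1) (N.mul_lact a b p.2)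

/-- The extension of the left module `N` by `M` with action
`a · (x, y) = (a · x + f(a, y), a · y)`. -/
noncomputable def extension (M : LeftModule A X) (N : LeftModule A Y) (f : A →L[ℂ] Y →L[ℂ] X)
    (hf : ∀ a b y, M.lact a (f b y) - f (a * b) y + f a (N.lact b y) = 0) :
    LeftModule A (X × Y) where
  lact := (M.prod N).lact + ContinuousLinearMap.compL ℂ (X × Y) X (X × Y)
    (ContinuousLinearMap.inl ℂ X Y) ∘L (f.flip ∘L ContinuousLinearMap.snd ℂ X Y).flip
  mul_lact a b p := by
    refine Prod.ext ?_ ?_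
    · change M.lact (a * b) p.1 + f (a * b) p.2 =
        M.lact a (M.lact b p.1 + f b p.2) + f a (N.lact b p.2 + 0)
      rw [M.mul_lact, map_add, add_zero, ← sub_eq_zero, ← neg_eq_zero, ← hf a b p.2]
      abel
    · change N.lact (a * b) p.2 + 0 = N.lact a (N.lact b p.2 + 0) + 0
      simp only [add_zero, N.mul_lact]

/-- A left Banach module, as a bimodule with zero right action. -/
noncomputable def rightAnnihilator (M : LeftModule A X) : Bimodule A X where
  toLeftModule := M
  ract := 0
  mul_ract _ _ _ := by simp only [zero_apply]
  lact_ract _ _ _ := by simp only [zero_apply, map_zero]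

theorem isRightAnnihilator_rightAnnihilator (M : LeftModule A X) :
    M.rightAnnihilator.IsRightAnnihilator := fun _ _ => rfl

/-- The bounded bilinear map `(a, x) ↦ a · σ x - σ (a · x)`, which measures how far the bounded
linear map `σ` is from being a morphism. -/
noncomputable def defect (M : LeftModule A X) (N : LeftModule A Y) (σ : X →L[ℂ] Y) :
    A →L[ℂ] X →L[ℂ] Y :=
  (N.lact.flip ∘L σ).flip - ContinuousLinearMap.compL ℂ X X Y σ ∘L M.lact

theorem defect_apply (M : LeftModule A X) (N : LeftModule A Y) (σ : X →L[ℂ] Y) (a : A) (x : X) :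
    M.defect N σ a x = N.lact a (σ x) - σ (M.lact a x) := rfl

theorem isMorphism_iff_defect_eq_zero {M : LeftModule A X} {N : LeftModule A Y} {σ : X →L[ℂ] Y} :
    IsMorphism M N σ ↔ ∀ a x, M.defect N σ a x = 0 :=
  forall₂_congr fun _ _ => eq_comm.trans sub_eq_zero.symm

theorem defect_cocycle (M : LeftModule A X) (N : LeftModule A Y) (σ : X →L[ℂ] Y) (a b : A)
    (x : X) : N.lact a (M.defect N σ b x) - M.defect N σ (a * b) x +
      M.defect N σ a (M.lact b x) = 0 := by
  simp only [defect_apply, map_sub, M.mul_lact, N.mul_lact]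
  abel

end LeftModule

variable {A : Type u} [NonUnitalNormedRing A] [NormedSpace ℂ A]

theorem Bimodule.IsRightAnnihilator.mem_cocycles₂_iff {X : Type*} [NormedAddCommGroup X]
    [NormedSpace ℂ X] {M : Bimodule A X} (hM : M.IsRightAnnihilator) {f : A →L[ℂ] A →L[ℂ] X} :
    f ∈ M.cocycles₂ ↔ ∀ a b c, M.lact a (f b c) - f (a * b) c + f a (b * c) = 0 := by
  refine forall₃_congr fun a b c => ?_
  rw [hM, sub_zero]

theorem Bimodule.IsRightAnnihilator.mem_coboundaries₂_iff {X : Type*} [NormedAddCommGroup X]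
    [NormedSpace ℂ X] {M : Bimodule A X} (hM : M.IsRightAnnihilator) {f : A →L[ℂ] A →L[ℂ] X} :
    f ∈ M.coboundaries₂ ↔ ∃ g : A →L[ℂ] X, ∀ a b, f a b = M.lact a (g b) - g (a * b) := by
  refine exists_congr fun g => forall₂_congr fun a b => ?_
  rw [hM, add_zero]

theorem Bimodule.IsRightAnnihilator.subsingleton_H₂_iff {X : Type*} [NormedAddCommGroup X]
    [NormedSpace ℂ X] {M : Bimodule A X} (hM : M.IsRightAnnihilator) :
    Subsingleton M.H₂ ↔ ∀ f : A →L[ℂ] A →L[ℂ] X,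
      (∀ a b c, M.lact a (f b c) - f (a * b) c + f a (b * c) = 0) →
        ∃ g : A →L[ℂ] X, ∀ a b, f a b = M.lact a (g b) - g (a * b) := by
  refine (Submodule.Quotient.subsingleton_iff.trans Submodule.submoduleOf_eq_top).trans
    (forall_congr' fun f => ?_)
  rw [← hM.mem_cocycles₂_iff, ← hM.mem_coboundaries₂_iff]

variable [IsScalarTower ℂ A A] [SMulCommClass ℂ A A]

theorem IsLeftProjective.h₂VanishesOnRightAnnihilator [CompleteSpace A]
    (hA : IsLeftProjective A) : H₂VanishesOnRightAnnihilator A := by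
  refine fun X _ _ _ M hM => hM.subsingleton_H₂_iff.2 fun f hf => ?_
  obtain ⟨ψ, hψ, h_section⟩ := hA (X × A) (M.extension (LeftModule.self A) f hf)
    (ContinuousLinearMap.snd ℂ X A) (fun a p => add_zero _)
    ⟨ContinuousLinearMap.inr ℂ X A, rfl⟩
  refine ⟨-(ContinuousLinearMap.fst ℂ X A ∘L ψ), fun a b => ?_⟩
  have h_fst : (ψ (a * b)).1 = M.lact a (ψ b).1 + f a (ψ b).2 := congrArg Prod.fst (hψ a b)
  have h_snd : (ψ b).2 = b := DFunLike.congr_fun h_section b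
  change f a b = M.lact a (-(ψ b).1) - -(ψ (a * b)).1
  rw [h_fst, h_snd, map_neg]
  abel

theorem H₂VanishesOnRightAnnihilator.isLeftProjective
    (hA : H₂VanishesOnRightAnnihilator A) : IsLeftProjective A := by
  rintro Y _ _ _ N φ hφ ⟨σ, hσ⟩
  have hφσ (a : A) : φ (σ a) = a := DFunLike.congr_fun hσ a
  have : CompleteSpace φ.ker := φ.isClosed_ker.completeSpace_coe
  have h_lact (a : A) (y : Y) (hy : y ∈ φ.ker) : N.lact a y ∈ φ.ker := by
    change φ (N.lact a y) = 0
    rw [hφ, show φ y = 0 from hy, map_zero]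
  have h_defect (a b : A) : (LeftModule.self A).defect N σ a b ∈ φ.ker := by
    change φ _ = 0
    rw [LeftModule.defect_apply, map_sub, hφ, hφσ, hφσ, sub_self]
  let K := N.restrict φ.ker h_lact
  obtain ⟨g, hg⟩ := K.isRightAnnihilator_rightAnnihilator.subsingleton_H₂_iff.1
    (hA φ.ker _ K.isRightAnnihilator_rightAnnihilator)
    (codRestrictBilinear ((LeftModule.self A).defect N σ) φ.ker h_defect)
    fun a b c => Subtype.ext (LeftModule.defect_cocycle _ N σ a b c)
  have hg_defect (a b : A) : (LeftModule.self A).defect N σ a b =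
      (LeftModule.self A).defect N (φ.ker.subtypeL ∘L g) a b := congrArg Subtype.val (hg a b)
  refine ⟨σ - φ.ker.subtypeL ∘L g, LeftModule.isMorphism_iff_defect_eq_zero.2 fun a b => ?_, ?_⟩
  · rw [← sub_eq_zero.2 (hg_defect a b)]
    simp only [LeftModule.defect_apply, sub_apply, map_sub]
    abel
  · ext b
    change φ (σ b - g b) = b
    rw [map_sub, hφσ, show φ (g b) = 0 from (g b).2, sub_zero]

end Cohomology

section DiagonalModule

open scoped BoundedContinuousFunction

instance {α 𝕜 β : Type*} [TopologicalSpace α] [NormedField 𝕜] [SeminormedAddCommGroup β]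
    [NormedSpace 𝕜 β] : IsScalarTower 𝕜 (α →ᵇ 𝕜) (α →ᵇ β) :=
  ⟨fun r f g => BoundedContinuousFunction.ext fun x => smul_assoc r (f x) (g x)⟩

variable (A : Type u) [NonUnitalCStarAlgebra A]

/-- The Gelfand transform of a possibly nonunital C⋆-algebra, with values in the bounded
continuous functions on the spectrum. -/
noncomputable def gelfandTransformBCF : A →L[ℂ] (characterSpace ℂ A →ᵇ ℂ) :=
  LinearMap.mkContinuous
    { toFun := fun a => BoundedContinuousFunction.ofNormedAddCommGroup (fun χ => χ a)
        (continuous_character_apply a) ‖a‖ fun χ => NonUnitalStarAlgHom.norm_apply_le χ a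
      map_add' := fun _ _ => BoundedContinuousFunction.ext fun χ => map_add χ _ _
      map_smul' := fun _ _ => BoundedContinuousFunction.ext fun χ => map_smul χ _ _ }
    1 fun a => by
      rw [one_mul]
      exact BoundedContinuousFunction.norm_ofNormedAddCommGroup_le _ (norm_nonneg a)
        fun χ => NonUnitalStarAlgHom.norm_apply_le χ a

/-- The left Banach module of bounded continuous functions from the spectrum of `A` to `A`, on which
`A` acts through its Gelfand transform: `(a · F) χ = χ(a) F(χ)`. -/
noncomputable def spectralModule : LeftModule A (characterSpace ℂ A →ᵇ A) where
  lact := ContinuousLinearMap.lsmul ℂ (characterSpace ℂ A →ᵇ ℂ) ∘L gelfandTransformBCF A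
  mul_lact a b F := BoundedContinuousFunction.ext fun χ => by
    change χ (a * b) • F χ = χ a • χ b • F χ
    rw [map_mul, mul_smul]

/-- The pairs `(F, a)` such that the function `χ ↦ χ(F(χ))`, the restriction of `F` to the diagonal,
is the Gelfand transform of `a`. -/
def diagonalSubmodule : Submodule ℂ ((characterSpace ℂ A →ᵇ A) × A) where
  carrier := {p | ∀ χ : characterSpace ℂ A, χ (p.1 χ) = χ p.2}
  zero_mem' _ := rfl
  add_mem' {p q} hp hq χ := by
    simp only [Prod.fst_add, Prod.snd_add, BoundedContinuousFunction.add_apply, map_add, hp χ, hq χ]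
  smul_mem' r p hp χ := by
    simp only [Prod.smul_fst, Prod.smul_snd, BoundedContinuousFunction.smul_apply, map_smul, hp χ]

theorem isClosed_diagonalSubmodule :
    IsClosed (diagonalSubmodule A : Set ((characterSpace ℂ A →ᵇ A) × A)) := by
  change IsClosed {p : (characterSpace ℂ A →ᵇ A) × A | ∀ χ : characterSpace ℂ A, χ (p.1 χ) = χ p.2}
  rw [Set.ofPred_forall]
  refine isClosed_iInter fun χ => isClosed_eq ?_ ((map_continuous χ).comp continuous_snd)
  exact (map_continuous χ).comp
    ((BoundedContinuousFunction.evalCLM ℂ χ).continuous.comp continuous_fst)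

/-- The left Banach module structure on `diagonalSubmodule A`. -/
noncomputable def diagonalModule : LeftModule A (diagonalSubmodule A) :=
  ((spectralModule A).prod (LeftModule.self A)).restrict (diagonalSubmodule A) fun a p hp χ => by
    change χ (χ a • p.1 χ) = χ (a * p.2)
    rw [map_smul, hp χ, map_mul, smul_eq_mul]

variable {A}

theorem IsLeftProjective.exists_diagonal_section (hA : IsLeftProjective A) :
    ∃ F : A →L[ℂ] (characterSpace ℂ A →ᵇ A),
      IsMorphism (LeftModule.self A) (spectralModule A) F ∧
        ∀ (a : A) (χ : characterSpace ℂ A), χ (F a χ) = χ a := by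
  have : CompleteSpace (diagonalSubmodule A) := (isClosed_diagonalSubmodule A).completeSpace_coe
  let const : A →L[ℂ] (characterSpace ℂ A →ᵇ A) := LinearMap.mkContinuous
    { toFun := BoundedContinuousFunction.const _
      map_add' := fun _ _ => rfl
      map_smul' := fun _ _ => rfl }
    1 fun a => (BoundedContinuousFunction.norm_const_le a).trans_eq (one_mul _).symm
  obtain ⟨ψ, hψ, h_section⟩ := hA (diagonalSubmodule A) (diagonalModule A)
    (ContinuousLinearMap.snd ℂ _ _ ∘L (diagonalSubmodule A).subtypeL) (fun a p => rfl)
    ⟨(const.prod (ContinuousLinearMap.id ℂ A)).codRestrict (diagonalSubmodule A) fun _ _ => rfl,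
      rfl⟩
  refine ⟨ContinuousLinearMap.fst ℂ _ _ ∘L (diagonalSubmodule A).subtypeL ∘L ψ,
    fun a b => congrArg (fun p => p.1.1) (hψ a b), fun a χ => ?_⟩
  have h_snd : (ψ a).1.2 = a := DFunLike.congr_fun h_section a
  exact ((ψ a).2 χ).trans (congrArg χ h_snd)

theorem IsLeftProjective.exists_isNowhereVanishing {A : Type u} [NonUnitalCommCStarAlgebra A]
    (hA : IsLeftProjective A) {a₀ : A} (ha₀ : IsRegular a₀) : ∃ h : A, IsNowhereVanishing h := by
  obtain ⟨F, hF, hF_diag⟩ := hA.exists_diagonal_section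
  have hF_mul (a b : A) (χ : characterSpace ℂ A) : F (a * b) χ = χ a • F b χ :=
    DFunLike.congr_fun (hF a b) χ
  obtain ⟨K, hK, hKu⟩ := isSigmaCompact_character_ne_zero a₀
  obtain ⟨c, hc, hcK⟩ := TopologicalSpace.IsSeparable.iUnion fun n =>
    ((hK n).image (F a₀).continuous).isSeparable
  rw [← Set.image_iUnion, hKu] at hcK
  refine exists_isNowhereVanishing_of_countable hc fun χ => ?_
  by_contra! hc_zero
  have h_closure : closure c ⊆ {a | χ a = 0} :=
    closure_minimal hc_zero (isClosed_eq (map_continuous χ) continuous_const)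
  obtain ⟨b, hb⟩ := exists_character_apply_ne_zero χ
  -- `F b` is proportional to `F a₀` wherever the Gelfand transform of `a₀` does not vanish.
  have h_zero : {s : characterSpace ℂ A | s a₀ ≠ 0} ⊆ {s | χ (F b s) = 0} := by
    intro s hs
    have h_comm : s a₀ • F b s = s b • F a₀ s := by rw [← hF_mul, ← hF_mul, mul_comm]
    have h_apply := congrArg χ h_comm
    rw [map_smul, map_smul, h_closure (hcK (Set.mem_image_of_mem _ hs)), smul_zero,
      smul_eq_zero] at h_apply
    exact h_apply.resolve_left hs
  have h_univ := closure_minimal h_zero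
    (isClosed_eq ((map_continuous χ).comp (F b).continuous) continuous_const)
  rw [(dense_character_ne_zero ha₀).closure_eq] at h_univ
  exact hb ((hF_diag b χ).symm.trans (h_univ (Set.mem_univ χ)))

end DiagonalModule

section Separability

variable {A : Type u} [NonUnitalCommCStarAlgebra A]

theorem exists_isRegular_of_forall_mul_eq_zero {c : ℕ → A}
    (hc : ∀ b : A, (∀ n, c n * b = 0) → b = 0) : ∃ a : A, IsRegular a := by
  obtain ⟨a₀, ha₀⟩ := exists_character_eq_zero_iff c
  refine ⟨a₀, isLeftRegular_iff_isRegular.1 (isLeftRegular_iff_right_eq_zero_of_mul.2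
    fun b hb => hc b fun n => ?_)⟩
  refine eq_of_forall_character fun χ => ?_
  have h_zero := congrArg χ hb
  rw [map_mul, map_zero, mul_eq_zero] at h_zero ⊢
  exact h_zero.imp_left fun h => (ha₀ χ).1 h n

theorem exists_isRegular_of_injective {E : Type*} [NormedAddCommGroup E] [NormedSpace ℂ E]
    [TopologicalSpace.SeparableSpace E] (π : A →ₙ+* (E →L[ℂ] E))
    (hπ : Function.Injective π) : ∃ a : A, IsRegular a := by
  obtain ⟨c, hc⟩ := TopologicalSpace.exists_dense_seq (Set.range fun p : A × E => π p.1 p.2)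
  choose p hp using fun n => (c n).2
  refine exists_isRegular_of_forall_mul_eq_zero (c := fun n => (p n).1) fun b hb => ?_
  have h_seq (n : ℕ) : π b (c n) = 0 := by
    rw [← hp n, ← mul_apply_eq_comp, ← map_mul, mul_comm, hb, map_zero, zero_apply]
  have h_range (y : Set.range fun p : A × E => π p.1 p.2) : π b y = 0 :=
    congrFun (DenseRange.equalizer hc ((π b).continuous.comp continuous_subtype_val)
      continuous_const (funext h_seq)) y
  have h_star : b * star b = 0 := hπ (ContinuousLinearMap.ext fun x => by
    rw [map_mul, map_zero]
    exact h_range ⟨π (star b) x, (star b, x), rfl⟩)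
  exact (CStarRing.mul_star_self_eq_zero_iff b).1 h_star

end Separability

/-- A norm-closed commutative star subalgebra of `B(H)`, as a commutative C⋆-algebra. -/
noncomputable abbrev nonUnitalCommCStarAlgebraOfIsClosed {H : Type*} [NormedAddCommGroup H]
    [InnerProductSpace ℂ H] [CompleteSpace H] (D : NonUnitalStarSubalgebra ℂ (H →L[ℂ] H))
    (hclosed : IsClosed (D : Set (H →L[ℂ] H))) (hcomm : ∀ x ∈ D, ∀ y ∈ D, x * y = y * x) :
    NonUnitalCommCStarAlgebra D :=
  { NonUnitalStarSubalgebra.nonUnitalCStarAlgebra D (h_closed := hclosed) with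
    mul_comm := fun x y => Subtype.ext (hcomm x x.2 y y.2) }

end BanachHomology

open BanachHomology WeakDual in
theorem corollary6p4_general {A : Type u} [NonUnitalCommCStarAlgebra A]
    (hA : ∃ a : A, IsRegular a) :
    List.TFAE [
      IsLeftProjective A,
      ParacompactSpace (characterSpace ℂ A),
      ∃ h : A, IsStrictlyPositiveElement h,
      SigmaCompactSpace (characterSpace ℂ A),
      LindelofSpace (characterSpace ℂ A),
      HasSequentialApproxIdentity A,
      H₂VanishesOnRightAnnihilator A] := by
  obtain ⟨a₀, ha₀⟩ := hA
  tfae_have 1 → 4 := fun h =>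
    let ⟨_, hh⟩ := h.exists_isNowhereVanishing ha₀
    hh.sigmaCompactSpace
  tfae_have 4 → 2 := fun _ => inferInstance
  tfae_have 2 → 4 := fun _ =>
    let ⟨_, hh⟩ := exists_isNowhereVanishing_of_paracompactSpace ha₀
    hh.sigmaCompactSpace
  tfae_have 4 → 5 := fun _ => inferInstance
  tfae_have 5 → 6 := fun _ =>
    let ⟨_, hh⟩ := exists_isNowhereVanishing_of_lindelofSpace (A := A)
    let ⟨_, he⟩ := hh.exists_isAlmostIdempotentApproxUnit
    he.hasSequentialApproxIdentity
  tfae_have 6 → 3 := fun h => h.exists_isStrictlyPositiveElement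
  tfae_have 3 → 1 := fun ⟨_, hh⟩ =>
    let ⟨_, he⟩ := hh.isNowhereVanishing.exists_isAlmostIdempotentApproxUnit
    he.isLeftProjective
  tfae_have 1 → 7 := fun h => h.h₂VanishesOnRightAnnihilator
  tfae_have 7 → 1 := fun h => h.isLeftProjective
  tfae_finish

theorem corollary6p4 {H : Type u} [NormedAddCommGroup H] [InnerProductSpace ℂ H] [CompleteSpace H]
    [TopologicalSpace.SeparableSpace H]
    (D : NonUnitalStarSubalgebra ℂ (H →L[ℂ] H)) (hclosed : IsClosed (D : Set (H →L[ℂ] H)))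
    (hcomm : ∀ x ∈ D, ∀ y ∈ D, x * y = y * x) :
    List.TFAE [
      BanachHomology.IsLeftProjective D,
      ParacompactSpace (WeakDual.characterSpace ℂ D),
      ∃ h : D, BanachHomology.IsStrictlyPositiveElement h,
      SigmaCompactSpace (WeakDual.characterSpace ℂ D),
      LindelofSpace (WeakDual.characterSpace ℂ D),
      BanachHomology.HasSequentialApproxIdentity D,
      BanachHomology.H₂VanishesOnRightAnnihilator D] := by
  let _ := BanachHomology.nonUnitalCommCStarAlgebraOfIsClosed D hclosed hcomm
  exact corollary6p4_general (BanachHomology.exists_isRegular_of_injective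
    (NonUnitalSubringClass.subtype D) Subtype.val_injective)
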